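/- Let $k$ be a field of characteristic $0$, let $\mathfrak g$ be a $k$-Lie algebra with a totally ordered basis $B=(b_i)_{i\in I}$ (of any cardinality), and let $\mathcal U=\mathcal U(\mathfrak g)$ be its enveloping algebra. For a finitely supported $\alpha\in\mathbb N^{(I)}$ with support $\{i_1>i_2>\dots>i_m\}$ put $B^\alpha=b_{i_1}^{\alpha(i_1)}b_{i_2}^{\alpha(i_2)}\cdots b_{i_m}^{\alpha(i_m)}\in\mathcal U$; in particular $B^{e_i}=b_i$, where $e_i(j)=\delta_{ij}$. The family $(B^\alpha)_{\alpha\in\mathbb N^{(I)}}$ is a basis of $\mathcal U$ (the Poincaré–Birkhoff–Witt basis); let $(S_\alpha)_{\alpha\in\mathbb N^{(I)}}$ be its dual family, i.e. the linear forms on $\mathcal U$ with $\langle S_\alpha, B^\beta\rangle=\delta_{\alpha,\beta}$. Read $f\otimes v\in\mathcal U^*\otimes\mathcal U$ as the endomorphism $x\mapsto f(x)\,v$ of $\mathcal U$. Equip $\mathrm{End}_k(\mathcal U)$ with the convolution product $f*h=\mu\circ(f\otimes h)\circ\Delta$, where $\mu$ is the multiplication of $\mathcal U$ and $\Delta:\mathcal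 U\to\mathcal U\otimes\mathcal U$ is the algebra morphism with $\Delta(x)=x\otimes 1+1\otimes x$ for $x\in\mathfrak g$ (the unit is $x\mapsto\varepsilon(x)1$, where the counit $\varepsilon:\mathcal U\to k$ is the algebra morphism vanishing on $\mathfrak g$), and with the topology of pointwise convergence, $\mathcal U$ being discrete. Infinite sums are limits of the net of finite partial sums, $\exp(f)=\sum_{n\ge 0} f^{*n}/n!$, and the infinite product $\prod^{\rightarrow}_{i\in I} f_i$ is the limit of the net of finite partial products $f_{i_1}*f_{i_2}*\cdots*f_{i_m}$ over the finite subsets $\{i_1>i_2>\dots>i_m\}$ of $I$ (factors in the same order as in $B^\alpha$). Then all the sums, exponentials and products below converge, and $$\sum_{\alpha\in\mathbb N^{(I)}} S_\alpha\otimes B^\alpha \;=\; \prod^{\rightarrow}_{i\in I}\exp\,(S_{e_i}\otimes B^{e_i}) \;=\; \mathrm{Id}_{\mathcal U}.$$ -/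

import Mathlib

open scoped TensorProduct

noncomputable section

namespace UniversalEnvelopingAlgebra

section Coproduct

attribute [local instance 100] LieRing.ofAssociativeRing
attribute [local instance 2000] Algebra.toModule

variable (k : Type*) (g : Type*) [CommRing k] [LieRing g] [LieAlgebra k g]

/-- The Lie algebra morphism `x ↦ x ⊗ 1 + 1 ⊗ x` from `g` to `U(g) ⊗ U(g)`. -/
def comulLie :
    g →ₗ⁅k⁆ UniversalEnvelopingAlgebra k g ⊗[k] UniversalEnvelopingAlgebra k g where
  toFun x := ι k x ⊗ₜ[k] 1 + 1 ⊗ₜ[k] ι k x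
  map_add' x y := by
    simp only [map_add, TensorProduct.add_tmul, TensorProduct.tmul_add]; abel
  map_smul' c x := by
    simp only [map_smul, TensorProduct.smul_tmul', TensorProduct.tmul_smul, smul_add,
      RingHom.id_apply]
  map_lie' := by
    intro x y
    simp only [LieHom.map_lie, LieRing.of_associative_ring_bracket, mul_add, add_mul,
      Algebra.TensorProduct.tmul_mul_tmul, mul_one, one_mul, TensorProduct.sub_tmul,
      TensorProduct.tmul_sub]
    abel

/-- The coproduct of `U(g)`: the algebra morphism with `Δ(x) = x ⊗ 1 + 1 ⊗ x` for `x ∈ g`. -/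
def comulHom : UniversalEnvelopingAlgebra k g →ₐ[k]
    UniversalEnvelopingAlgebra k g ⊗[k] UniversalEnvelopingAlgebra k g :=
  lift k (comulLie k g)

/-- The counit of `U(g)`: the algebra morphism with `ε(x) = 0` for `x ∈ g`. -/
def counitHom : UniversalEnvelopingAlgebra k g →ₐ[k] k :=
  lift k (0 : g →ₗ⁅k⁆ k)

theorem comulHom_ι (x : g) :
    comulHom k g (ι k x) = ι k x ⊗ₜ[k] 1 + 1 ⊗ₜ[k] ι k x :=
  lift_ι_apply k (comulLie k g) x

theorem counitHom_ι (x : g) : counitHom k g (ι k x) = 0 :=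
  lift_ι_apply k (0 : g →ₗ⁅k⁆ k) x

theorem algHom_ext_ι {A : Type*} [Ring A] [Algebra k A]
    {φ ψ : UniversalEnvelopingAlgebra k g →ₐ[k] A} (h : ∀ x, φ (ι k x) = ψ (ι k x)) : φ = ψ :=
  hom_ext k (LieHom.ext h)

/-- The usual (cocommutative) bialgebra structure on the enveloping algebra. -/
instance instBialgebra : Bialgebra k (UniversalEnvelopingAlgebra k g) :=
  Bialgebra.ofAlgHom (comulHom k g) (counitHom k g)
    (by
      apply algHom_ext_ι
      intro x
      simp [comulHom_ι, -ι_apply, TensorProduct.add_tmul, TensorProduct.tmul_add,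
        Algebra.TensorProduct.one_def, add_assoc])
    (by
      apply algHom_ext_ι
      intro x
      simp [comulHom_ι, counitHom_ι, -ι_apply])
    (by
      apply algHom_ext_ι
      intro x
      simp [comulHom_ι, counitHom_ι, -ι_apply])

end Coproduct

end UniversalEnvelopingAlgebra

namespace PBWFactorization

/-- The product of `f i` over `i ∈ F`, the factors being multiplied from left to right in
decreasing order of their indices: `f i₁ * f i₂ * ⋯ * f iₘ` if `F = {i₁ > i₂ > ⋯ > iₘ}`. -/
def orderedProd {I A : Type*} [LinearOrder I] [Monoid A] (F : Finset I) (f : I → A) : A :=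
  ((F.sort (fun i j => i ≥ j)).map f).prod

/-- The multi-index power `Y ^ α = y_{i₁} ^ α(i₁) ⋯ y_{iₘ} ^ α(iₘ)`, where
`i₁ > ⋯ > iₘ` are the elements of the support of `α`. -/
def multiPow {I A : Type*} [LinearOrder I] [Monoid A] (y : I → A) (α : I →₀ ℕ) : A :=
  orderedProd α.support (fun i => y i ^ α i)

section

variable {k g I : Type*} [Field k] [LieRing g] [LieAlgebra k g] [LinearOrder I]

/-- The PBW monomial `B ^ α` in `U(g)` attached to an ordered basis `b` of `g`. -/
def pbwMonomial (b : Module.Basis I k g) (α : I →₀ ℕ) : UniversalEnvelopingAlgebra k g :=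
  multiPow (fun i => UniversalEnvelopingAlgebra.ι k (b i)) α

end

section

variable (k g : Type*) [Field k] [LieRing g] [LieAlgebra k g]

/-- The linear endomorphisms of `U(g)`, with the convolution product
`f * h = μ ∘ (f ⊗ h) ∘ Δ`, whose unit is `1 ∘ ε`. -/
abbrev ConvEnd : Type _ :=
  WithConv (UniversalEnvelopingAlgebra k g →ₗ[k] UniversalEnvelopingAlgebra k g)

end

section

variable {k g : Type*} [Field k] [LieRing g] [LieAlgebra k g]

/-- The endomorphism `x ↦ f(x) v` represented by `f ⊗ v ∈ U(g)* ⊗ U(g)`. -/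
def tensorEnd (f : Module.Dual k (UniversalEnvelopingAlgebra k g))
    (v : UniversalEnvelopingAlgebra k g) : ConvEnd k g :=
  WithConv.toConv (dualTensorHom k (UniversalEnvelopingAlgebra k g)
    (UniversalEnvelopingAlgebra k g) (f ⊗ₜ[k] v))

/-- Convergence of a net of endomorphisms of `U(g)` in the topology of pointwise convergence,
`U(g)` being discrete. -/
def NetConverges {A : Type*} [Preorder A] (f : A → ConvEnd k g) (l : ConvEnd k g) : Prop :=
  ∀ x : UniversalEnvelopingAlgebra k g, ∃ N : A, ∀ i ≥ N, f i x = l x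

/-- The family `f` is summable with sum `l`: the net of finite partial sums converges to `l`. -/
def HasPointwiseSum {J : Type*} (f : J → ConvEnd k g) (l : ConvEnd k g) : Prop :=
  NetConverges (fun F : Finset J => ∑ j ∈ F, f j) l

/-- The family `f` is multipliable (for convolution) with product `l`: the net of finite partial
ordered convolution products converges to `l`. -/
def HasOrderedProd {J : Type*} [LinearOrder J] (f : J → ConvEnd k g) (l : ConvEnd k g) : Prop :=
  NetConverges (fun F : Finset J => orderedProd F f) l

/-- `e` is the convolution exponential of `f`, i.e. the sum of the series `∑ f ^ n / n!`. -/
def IsConvExp (f e : ConvEnd k g) : Prop :=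
  HasPointwiseSum (fun n : ℕ => ((n.factorial : k)⁻¹) • f ^ n) e

end

end PBWFactorization

end

/-!
The Poincaré–Birkhoff–Witt theorem gives the basis. Let `z_M`, for `M` a multiset of indices, be the
monomials of the symmetric algebra of `g`, and `B ^ M` the corresponding ordered monomials of the
enveloping algebra `U`. There is an action of `g` on the symmetric algebra with `b_i · z_M = z_{iM}`
whenever `i` is an upper bound of `M`; it is built by recursion on the degree (`actAux`, `act`), and
compatibility with the bracket (`lieDefect_eq_zero`) comes down to the Jacobi identity. The
extension of this action to `U` satisfies `B ^ M · z_0 = z_M`, hence the `B ^ M` are linearly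
independent. Conversely the linear map `z_M ↦ B ^ M` commutes with the actions of `g` (`toEnv_act`),
so its range is a left ideal containing `1`, hence the `B ^ M` span `U`. For this the order of the index set need
not be a well-order, as all inductions are on the degree.

The convergence statements can be tested on this basis. The sum of the `S_α ⊗ B ^ α` is the identity
because a single term contributes on each `B ^ β`. For the product, the coproduct of `B ^ M` is the
sum of the `B ^ P ⊗ B ^ Q` over all splittings `M = P + Q` with multiplicity (`comul_envMonomial`).
Therefore the `n`-th convolution power of `S_{e_i} ⊗ b_i` takes `b_i ^ n` to `n! b_i ^ n` and kills
the other monomials (`convPow_envMonomial`), and its exponential is the projection onto the span of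
the powers of `b_i` (`isConvExp_supportProj`). Finally the ordered convolution product of these
projections over a finite set `F` is the projection onto the span of the monomials in the `b_i` with
`i ∈ F` (`orderedProd_supportProj`), which fixes any given monomial as soon as `F` is large enough.
-/

noncomputable section

namespace PBWFactorization

open UniversalEnvelopingAlgebra (ι)

attribute [local instance 100] LieRing.ofAssociativeRing

theorem basis_induction {R V ι : Type*} [Semiring R] [AddCommMonoid V] [Module R V]
    (b : Module.Basis ι R V) {p : V → Prop} (zero : p 0) (add : ∀ x y, p x → p y → p (x + y))
    (smul : ∀ (c : R) x, p x → p (c • x)) (basis : ∀ i, p (b i)) (x : V) : p x := by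
  refine Submodule.span_induction (p := fun x _ => p x) ?_ zero (fun x y _ _ => add x y)
    (fun c x _ => smul c x) (b.mem_span x)
  rintro _ ⟨i, rfl⟩
  exact basis i

/-! ### Multisets built by adjoining maxima -/

section MultisetOrder

variable {I : Type*} [LinearOrder I]

/-- Induction on a multiset by adjoining a greatest element. -/
theorem multiset_induction_max {p : Multiset I → Prop} (zero : p 0)
    (cons : ∀ i M, (∀ j ∈ M, j ≤ i) → p M → p (i ::ₘ M)) (M : Multiset I) : p M := by
  have key : ∀ l : List I, l.Pairwise (fun i j => i ≥ j) → p (l : Multiset I) := by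
    intro l
    induction l with
    | nil => intro _; exact zero
    | cons i l ih =>
      intro h
      rw [List.pairwise_cons] at h
      rw [← Multiset.cons_coe]
      exact cons i l (fun j hj => h.1 j (by simpa using hj)) (ih h.2)
  have := key _ (Multiset.pairwise_sort M (fun i j => i ≥ j))
  rwa [Multiset.sort_eq] at this

/-- If `i` is not an upper bound of `M`, then `i` is less than the maximum of `M`. -/
theorem exists_eq_max_cons {i : I} {M : Multiset I} (h : ¬∀ j ∈ M, j ≤ i) :
    ∃ m L, (∀ j ∈ L, j ≤ m) ∧ i < m ∧ M = m ::ₘ L := by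
  induction M using multiset_induction_max with
  | zero => simp at h
  | cons m L hm _ =>
    refine ⟨m, L, hm, lt_of_not_ge fun hmi => h ?_, rfl⟩
    exact Multiset.forall_mem_cons.2 ⟨hmi, fun j hj => (hm j hj).trans hmi⟩

end MultisetOrder

/-! ### Monomials of the symmetric algebra and their degree -/

section Filtration

variable {k I : Type*} [CommRing k]

variable (k) in
/-- The monomial `z_M = ∏_{i ∈ M} z_i` of the symmetric algebra of a Lie algebra with basis indexed
by `I`. Only the linear structure of that algebra matters, so it is taken to be `Multiset I →₀ k`,
the free module on the monomials. -/
abbrev symMonomial (M : Multiset I) : Multiset I →₀ k := Finsupp.single M 1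

variable (k I) in
/-- The elements of degree at most `n` of the symmetric algebra. -/
def symFilt (n : ℕ) : Submodule k (Multiset I →₀ k) :=
  Finsupp.supported k k {M | M.card ≤ n}

theorem symMonomial_mem_symFilt {M : Multiset I} {n : ℕ} (h : M.card ≤ n) :
    symMonomial k M ∈ symFilt k I n :=
  Finsupp.single_mem_supported k _ h

theorem symFilt_mono {m n : ℕ} (h : m ≤ n) : symFilt k I m ≤ symFilt k I n :=
  Finsupp.supported_mono fun _ hM => le_trans hM h

/-- A submodule that contains the monomials of degree at most `n` contains `symFilt k I n`. -/
theorem symFilt_induction {n : ℕ} {p : Submodule k (Multiset I →₀ k)}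
    (h : ∀ M : Multiset I, M.card ≤ n → symMonomial k M ∈ p) {s : Multiset I →₀ k}
    (hs : s ∈ symFilt k I n) : s ∈ p := by
  rw [symFilt, Finsupp.supported_eq_span_single] at hs
  refine Submodule.span_le.2 ?_ hs
  rintro _ ⟨M, hM, rfl⟩
  exact h M hM

end Filtration

/-! ### The action of a Lie algebra on its symmetric algebra -/

section Action

variable {k g I : Type*} [CommRing k] [LieRing g] [LieAlgebra k g] [LinearOrder I]

/-- The action of `g` on the elements of degree at most `n` of the symmetric algebra, by recursion
on `n`. It is determined by `b_i · z_M = z_{iM}` if `i` is an upper bound of `M`, and by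
`b_i · z_{jN} = b_j · (b_i · z_N) + ⁅b_i, b_j⁆ · z_N` if `j > i` is an upper bound of `N`. In the
latter rule `b_i · z_N` has leading term `z_{iN}`, and `b_j · z_{iN} = z_{ijN}` by the former rule;
so only the remainder `b_i · z_N - z_{iN}`, of degree at most `card N`, is acted upon recursively.
The values on elements of degree greater than `n` are irrelevant. -/
def actAux (b : Module.Basis I k g) :
    ℕ → g →ₗ[k] (Multiset I →₀ k) →ₗ[k] (Multiset I →₀ k)
  | 0 => b.constr k fun i => Finsupp.linearCombination k fun M => symMonomial k (i ::ₘ M)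
  | n + 1 => b.constr k fun i => Finsupp.linearCombination k fun M =>
      if M.card ≤ n then actAux b n (b i) (symMonomial k M)
      -- The head of the list `M.sort` in decreasing order is the maximum of `M`.
      else match M.sort (fun i j => i ≥ j) with
        | [] => symMonomial k (i ::ₘ M)
        | j :: L =>
          if j ≤ i then symMonomial k (i ::ₘ M)
          else symMonomial k (i ::ₘ M)
            + actAux b n (b j)
              (actAux b n (b i) (symMonomial k (L : Multiset I)) - symMonomial k (i ::ₘ L))
            + actAux b n ⁅b i, b j⁆ (symMonomial k (L : Multiset I))

/-- The action of `g` on the symmetric algebra: `actAux b n` in degree `n`. -/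
def act (b : Module.Basis I k g) : g →ₗ[k] (Multiset I →₀ k) →ₗ[k] (Multiset I →₀ k) :=
  b.constr k fun i => Finsupp.linearCombination k fun M => actAux b M.card (b i) (symMonomial k M)

variable (b : Module.Basis I k g)

theorem act_symMonomial (x : g) (M : Multiset I) :
    act b x (symMonomial k M) = actAux b M.card x (symMonomial k M) := by
  have : (act b).flip (symMonomial k M) = (actAux b M.card).flip (symMonomial k M) :=
    b.ext fun i => by simp [act]
  exact LinearMap.congr_fun this x

theorem actAux_symMonomial (x : g) {M : Multiset I} {n : ℕ} (h : M.card ≤ n) :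
    actAux b n x (symMonomial k M) = act b x (symMonomial k M) := by
  induction n with
  | zero => rw [act_symMonomial, Nat.le_zero.1 h]
  | succ n ih =>
    rcases h.eq_or_lt with h | h
    · rw [act_symMonomial, h]
    · have h' : M.card ≤ n := Nat.lt_succ_iff.1 h
      have : (actAux b (n + 1)).flip (symMonomial k M) = (actAux b n).flip (symMonomial k M) :=
        b.ext fun i => by simp [actAux, h']
      rw [← ih h']
      exact LinearMap.congr_fun this x

/-- The stages `actAux b n` are compatible: each agrees with `act b` in degree `≤ n`. -/
theorem actAux_eq_act (x : g) {n : ℕ} {s : Multiset I →₀ k} (hs : s ∈ symFilt k I n) :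
    actAux b n x s = act b x s :=
  symFilt_induction (p := LinearMap.eqLocus (actAux b n x) (act b x))
    (fun _ hM => actAux_symMonomial b x hM) hs

theorem act_symMonomial_of_le {i : I} {M : Multiset I} (h : ∀ j ∈ M, j ≤ i) :
    act b (b i) (symMonomial k M) = symMonomial k (i ::ₘ M) := by
  rw [act_symMonomial]
  induction M using multiset_induction_max with
  | zero => simp [actAux]
  | cons j N hj _ =>
    rw [Multiset.card_cons]
    have h1 : (j ::ₘ N).sort (fun i j => i ≥ j) = j :: N.sort (fun i j => i ≥ j) :=
      Multiset.sort_cons _ _ _ hj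
    have h2 : j ≤ i := h j (Multiset.mem_cons_self _ _)
    simp [actAux, h1, h2]

/-- The recursion that defines `act`, valid once the remainder `b_i · z_N - z_{iN}` is known to
have degree at most `card N`, so that the truncated action computes it correctly. -/
theorem act_symMonomial_cons_of_sub_mem {i j : I} {N : Multiset I} (hj : ∀ l ∈ N, l ≤ j)
    (hij : i < j)
    (h : act b (b i) (symMonomial k N) - symMonomial k (i ::ₘ N) ∈ symFilt k I N.card) :
    act b (b i) (symMonomial k (j ::ₘ N)) = symMonomial k (i ::ₘ j ::ₘ N)
      + act b (b j) (act b (b i) (symMonomial k N) - symMonomial k (i ::ₘ N))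
      + act b ⁅b i, b j⁆ (symMonomial k N) := by
  have h1 : (j ::ₘ N).sort (fun i j => i ≥ j) = j :: N.sort (fun i j => i ≥ j) :=
    Multiset.sort_cons _ _ _ hj
  rw [act_symMonomial, ← actAux_eq_act b _ h, ← actAux_symMonomial b (b i) le_rfl,
    ← actAux_symMonomial b _ le_rfl, Multiset.card_cons]
  simp [actAux, h1, hij.not_ge, -Multiset.cons_coe]

theorem act_mem_symFilt_of_sub_mem {n : ℕ}
    (h : ∀ M : Multiset I, M.card ≤ n →
      ∀ i, act b (b i) (symMonomial k M) - symMonomial k (i ::ₘ M) ∈ symFilt k I M.card)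
    (x : g) {s : Multiset I →₀ k} (hs : s ∈ symFilt k I n) :
    act b x s ∈ symFilt k I (n + 1) := by
  refine symFilt_induction (p := (symFilt k I (n + 1)).comap (act b x)) (fun M hM => ?_) hs
  rw [Submodule.mem_comap]
  induction x using basis_induction b with
  | zero => simp
  | add x y hx hy => rw [map_add]; exact add_mem hx hy
  | smul c x hx => rw [map_smul]; exact Submodule.smul_mem _ _ hx
  | basis i =>
    have h1 := symFilt_mono (hM.trans n.le_succ) (h M hM i)
    have h2 : symMonomial k (i ::ₘ M) ∈ symFilt k I (n + 1) :=
      symMonomial_mem_symFilt (by simpa using hM)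
    simpa using add_mem h1 h2

/-- The action of `b_i` is multiplication by `z_i` up to terms of lower degree. -/
theorem act_symMonomial_sub_mem (i : I) (M : Multiset I) :
    act b (b i) (symMonomial k M) - symMonomial k (i ::ₘ M) ∈ symFilt k I M.card := by
  induction hn : M.card using Nat.strong_induction_on generalizing i M with
  | _ n ih =>
    subst hn
    by_cases hi : ∀ j ∈ M, j ≤ i
    · rw [act_symMonomial_of_le b hi, sub_self]
      exact zero_mem _
    · obtain ⟨j, N, hj, hij, rfl⟩ := exists_eq_max_cons hi
      rw [Multiset.card_cons] at ih ⊢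
      have hN := ih N.card (Nat.lt_succ_self _) i N rfl
      have hact : ∀ x : g, ∀ s ∈ symFilt k I N.card, act b x s ∈ symFilt k I (N.card + 1) :=
        fun x s hs => act_mem_symFilt_of_sub_mem b
          (fun P hP l => ih P.card (Nat.lt_succ_of_le hP) l P rfl) x hs
      rw [act_symMonomial_cons_of_sub_mem b hj hij hN, add_assoc, add_sub_cancel_left]
      exact add_mem (hact _ _ hN) (hact _ _ (symMonomial_mem_symFilt le_rfl))

theorem act_symMonomial_cons {i j : I} {N : Multiset I} (hj : ∀ l ∈ N, l ≤ j) (hij : i < j) :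
    act b (b i) (symMonomial k (j ::ₘ N)) =
      act b (b j) (act b (b i) (symMonomial k N)) + act b ⁅b i, b j⁆ (symMonomial k N) := by
  have h : ∀ l ∈ i ::ₘ N, l ≤ j := Multiset.forall_mem_cons.2 ⟨hij.le, hj⟩
  rw [act_symMonomial_cons_of_sub_mem b hj hij (act_symMonomial_sub_mem b i N), map_sub,
    act_symMonomial_of_le b h, Multiset.cons_swap i j N]
  abel

/-- The failure of `act b` to respect the bracket of `x` and `y`. -/
def lieDefect (x y : g) : (Multiset I →₀ k) →ₗ[k] (Multiset I →₀ k) :=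
  act b x ∘ₗ act b y - act b y ∘ₗ act b x - act b ⁅x, y⁆

theorem lieDefect_apply (x y : g) (s : Multiset I →₀ k) : lieDefect b x y s =
    act b x (act b y s) - act b y (act b x s) - act b ⁅x, y⁆ s := rfl

theorem lieDefect_swap (x y : g) (s : Multiset I →₀ k) :
    lieDefect b y x s = - lieDefect b x y s := by
  rw [lieDefect_apply, lieDefect_apply, ← lie_skew x y, map_neg, LinearMap.neg_apply]
  abel

theorem lieDefect_self (x : g) (s : Multiset I →₀ k) : lieDefect b x x s = 0 := by
  simp [lieDefect_apply]

theorem lieDefect_eq_zero_of_basis {s : Multiset I →₀ k}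
    (h : ∀ i j, lieDefect b (b i) (b j) s = 0) (x y : g) : lieDefect b x y s = 0 := by
  induction x using basis_induction b with
  | zero => simp [lieDefect_apply]
  | add x x' hx hx' =>
    have : lieDefect b (x + x') y s = lieDefect b x y s + lieDefect b x' y s := by
      simp only [lieDefect_apply, map_add, add_lie, LinearMap.add_apply]; abel
    rw [this, hx, hx', add_zero]
  | smul c x hx =>
    have : lieDefect b (c • x) y s = c • lieDefect b x y s := by
      simp only [lieDefect_apply, map_smul, smul_lie, LinearMap.smul_apply, smul_sub]
    rw [this, hx, smul_zero]
  | basis i =>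
    induction y using basis_induction b with
    | zero => simp [lieDefect_apply]
    | add x x' hx hx' =>
      have : lieDefect b (b i) (x + x') s =
          lieDefect b (b i) x s + lieDefect b (b i) x' s := by
        simp only [lieDefect_apply, map_add, lie_add, LinearMap.add_apply]; abel
      rw [this, hx, hx', add_zero]
    | smul c x hx =>
      have : lieDefect b (b i) (c • x) s = c • lieDefect b (b i) x s := by
        simp only [lieDefect_apply, map_smul, lie_smul, LinearMap.smul_apply, smul_sub]
      rw [this, hx, smul_zero]
    | basis j => exact h i j

/-- If one of the two indices is an upper bound of `M`, the bracket relation on `z_M` is the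
recursion that defines the action. -/
theorem lieDefect_symMonomial_of_le {i j : I} {M : Multiset I} (hj : ∀ l ∈ M, l ≤ j) (hij : i ≤ j) :
    lieDefect b (b i) (b j) (symMonomial k M) = 0 := by
  rcases hij.eq_or_lt with rfl | hij
  · exact lieDefect_self b _ _
  · rw [lieDefect_apply, act_symMonomial_of_le b hj, act_symMonomial_cons b hj hij]
    abel

/-- The symmetric algebra is a `g`-module. By induction on the degree of `z_M`: if neither `i` nor
`j` is an upper bound of `M`, the maximum `m` of `M` exceeds both; with `z_M = b_m · z_L`, both
`b_i · b_j · z_M` and `b_j · b_i · z_M` are rewritten by moving `b_m` to the left, and the Jacobi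
identity for `b_i`, `b_j`, `b_m` compares the results. -/
theorem lieDefect_eq_zero (x y : g) (s : Multiset I →₀ k) : lieDefect b x y s = 0 := by
  have key : ∀ M : Multiset I, ∀ x y : g, lieDefect b x y (symMonomial k M) = 0 := by
    intro M
    induction hn : M.card using Nat.strong_induction_on generalizing M with
    | _ n ih =>
    subst hn
    refine fun x y => lieDefect_eq_zero_of_basis b (fun i j => ?_) x y
    by_cases hmax : ∀ l ∈ M, l ≤ max i j
    · rcases le_total i j with hij | hij
      · rw [max_eq_right hij] at hmax
        exact lieDefect_symMonomial_of_le b hmax hij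
      · rw [max_eq_left hij] at hmax
        rw [lieDefect_swap, lieDefect_symMonomial_of_le b hmax hij, neg_zero]
    obtain ⟨m, L, hm, hlt, rfl⟩ := exists_eq_max_cons hmax
    obtain ⟨him, hjm⟩ := max_lt_iff.1 hlt
    have hL : ∀ x y : g, lieDefect b x y (symMonomial k L) = 0 := fun x y =>
      ih L.card (by simp) L rfl x y
    have hfilt : ∀ x y : g, ∀ s ∈ symFilt k I L.card, lieDefect b x y s = 0 := fun x y s hs =>
      symFilt_induction (p := LinearMap.ker (lieDefect b x y))
        (fun P hP => ih P.card (by simpa using Nat.lt_succ_of_le hP) P rfl x y) hs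
    -- `b_q · z_L` is `z_{qL}`, of which `m` is an upper bound, plus terms of degree
    -- lower than that of `z_M`.
    have hcomm : ∀ p q : I, p < m → q < m →
        lieDefect b (b p) (b m) (act b (b q) (symMonomial k L)) = 0 := by
      intro p q hp hq
      have h1 := hfilt (b p) (b m) _ (act_symMonomial_sub_mem b q L)
      have h2 : lieDefect b (b p) (b m) (symMonomial k (q ::ₘ L)) = 0 :=
        lieDefect_symMonomial_of_le b (Multiset.forall_mem_cons.2 ⟨hq.le, hm⟩) hp.le
      rwa [map_sub, h2, sub_zero] at h1
    have hexp : ∀ p q : I, p < m → q < m →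
        act b (b p) (act b (b q) (symMonomial k (m ::ₘ L))) =
          act b (b m) (act b (b p) (act b (b q) (symMonomial k L)))
          + act b ⁅b p, b m⁆ (act b (b q) (symMonomial k L))
          + act b ⁅b q, b m⁆ (act b (b p) (symMonomial k L))
          + act b ⁅b p, ⁅b q, b m⁆⁆ (symMonomial k L) := by
      intro p q hp hq
      have h1 := hcomm p q hp hq
      have h2 := hL (b p) ⁅b q, b m⁆
      rw [lieDefect_apply, sub_sub, sub_eq_zero] at h1 h2
      rw [act_symMonomial_cons b hm hq, map_add, h1, h2]
      abel
    have h3 := hL ⁅b i, b j⁆ (b m)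
    have h4 := hL (b i) (b j)
    have h5 : ⁅⁅b i, b j⁆, b m⁆ = ⁅b i, ⁅b j, b m⁆⁆ - ⁅b j, ⁅b i, b m⁆⁆ := lie_lie _ _ _
    rw [lieDefect_apply, sub_sub, sub_eq_zero] at h3 h4
    rw [h5, map_sub, LinearMap.sub_apply] at h3
    rw [lieDefect_apply, hexp i j him hjm, hexp j i hjm him, ← act_symMonomial_of_le b hm,
      h3, h4, map_add]
    abel
  have : lieDefect b x y = 0 := by
    ext1 M
    ext1
    simpa using key M x y
  rw [this, LinearMap.zero_apply]

end Action

/-! ### Ordered products -/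

section OrderedProd

variable {I A : Type*} [LinearOrder I] [Monoid A]

theorem orderedProd_empty (f : I → A) : orderedProd ∅ f = 1 := by
  simp [orderedProd]

theorem orderedProd_insert {i : I} {F : Finset I} (h : ∀ j ∈ F, j < i) (f : I → A) :
    orderedProd (insert i F) f = f i * orderedProd F f := by
  rw [orderedProd, Finset.sort_insert _ (fun j hj => (h j hj).le) fun hi => lt_irrefl i (h i hi),
    List.map_cons, List.prod_cons, orderedProd]

theorem orderedProd_congr {F : Finset I} {f f' : I → A} (h : ∀ j ∈ F, f j = f' j) :
    orderedProd F f = orderedProd F f' := by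
  rw [orderedProd, orderedProd, List.map_congr_left fun j hj => h j ((Finset.mem_sort _).1 hj)]

/-- Multiplying a multi-index power on the left by a variable whose index bounds the support is
raising the exponent of that variable. -/
theorem multiPow_single_add (y : I → A) {i : I} {α : I →₀ ℕ} (h : ∀ j ∈ α.support, j ≤ i) :
    multiPow y (Finsupp.single i 1 + α) = y i * multiPow y α := by
  classical
  have hlt : ∀ j ∈ α.support.erase i, j < i := fun j hj =>
    (h j (Finset.mem_of_mem_erase hj)).lt_of_ne (Finset.ne_of_mem_erase hj)
  have hsupp : (Finsupp.single i 1 + α).support = insert i (α.support.erase i) := by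
    ext j
    by_cases hj : j = i
    · subst hj; simp
    · simp [hj]
  have hrest : orderedProd (α.support.erase i)
      (fun j => y j ^ (Finsupp.single i 1 + α : I →₀ ℕ) j) =
      orderedProd (α.support.erase i) (fun j => y j ^ α j) :=
    orderedProd_congr fun j hj => by
      simp [Finset.ne_of_mem_erase hj]
  rw [multiPow, hsupp, orderedProd_insert hlt, hrest, multiPow]
  by_cases hi : i ∈ α.support
  · conv_rhs => rw [← Finset.insert_erase hi, orderedProd_insert hlt]
    rw [Finsupp.add_apply, Finsupp.single_eq_same, pow_add, pow_one, mul_assoc]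
  · rw [Finset.erase_eq_of_notMem hi, Finsupp.add_apply, Finsupp.single_eq_same,
      Finsupp.notMem_support_iff.1 hi, add_zero, pow_one]

end OrderedProd

/-! ### Sums over the ways to split a multiset -/

section Antidiagonal

variable {I A : Type*} [DecidableEq I] [AddCommMonoid A]

theorem sum_antidiagonal_ite_zero (h : Multiset I → A) (M : Multiset I) :
    (M.antidiagonal.map fun p => if p.1 = 0 then h p.2 else 0).sum = h M := by
  induction M using Multiset.induction_on generalizing h with
  | empty => simp
  | cons j M ih => simpa [Function.comp_def] using ih fun Q => h (j ::ₘ Q)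

/-- Exactly `M.count i` of the splittings of `M`, counted with multiplicity, have first part
`{i}`. -/
theorem sum_antidiagonal_ite_singleton (i : I) (h : Multiset I → A) (M : Multiset I) :
    (M.antidiagonal.map fun p => if p.1 = {i} then h p.2 else 0).sum =
      M.count i • h (M.erase i) := by
  induction M using Multiset.induction_on generalizing h with
  | empty => simp
  | cons j M ih =>
    have h1 := ih fun Q => h (j ::ₘ Q)
    have h2 := sum_antidiagonal_ite_zero h M
    by_cases hj : j = i
    · subst hj
      have h3 : M.count j • h (j ::ₘ M.erase j) = M.count j • h M := by
        by_cases hM : j ∈ M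
        · rw [Multiset.cons_erase hM]
        · rw [Multiset.count_eq_zero.2 hM, zero_smul, zero_smul]
      rw [h3] at h1
      simp only [Multiset.antidiagonal_cons, Multiset.map_add, Multiset.map_map, Multiset.sum_add,
        Function.comp_def, Prod.map_fst, Prod.map_snd, id_eq, h1, Multiset.count_cons_self,
        Multiset.erase_cons_head, succ_nsmul]
      congr 1
      rw [← h2]
      congr 2
      ext p
      simp [← Multiset.cons_zero]
    · have h4 : ∀ P : Multiset I, j ::ₘ P ≠ {i} := by
        intro P hP
        have : j ∈ ({i} : Multiset I) := hP ▸ Multiset.mem_cons_self j P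
        exact hj (Multiset.mem_singleton.1 this)
      simp only [Multiset.antidiagonal_cons, Multiset.map_add, Multiset.map_map, Multiset.sum_add,
        Function.comp_def, Prod.map_fst, Prod.map_snd, id_eq, h1, h4, if_false,
        Multiset.map_const', Multiset.sum_replicate, smul_zero, add_zero]
      rw [Multiset.count_cons_of_ne (Ne.symm hj), Multiset.erase_cons_tail _ hj]

end Antidiagonal

open Classical in
/-- The multiplicative form of the condition `M ⊆ T`, to which `Multiset.prod_map_add` applies. -/
theorem prod_map_indicator {k I : Type*} [CommSemiring k] (T : Set I) (M : Multiset I) :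
    (M.map (T.indicator fun _ => (1 : k))).prod = if ∀ j ∈ M, j ∈ T then 1 else 0 := by
  induction M using Multiset.induction_on with
  | empty => simp
  | cons i M ih =>
    rw [Multiset.map_cons, Multiset.prod_cons, ih]
    by_cases hi : i ∈ T <;> simp [hi]

/-! ### Generation of the enveloping algebra -/

/-- The enveloping algebra is generated by the image of `ι`. -/
theorem envelopingAlgebra_induction {k g : Type*} [CommRing k] [LieRing g] [LieAlgebra k g]
    {p : UniversalEnvelopingAlgebra k g → Prop}
    (algebraMap : ∀ c, p (algebraMap k (UniversalEnvelopingAlgebra k g) c))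
    (ι : ∀ x, p (UniversalEnvelopingAlgebra.ι k x))
    (mul : ∀ u v, p u → p v → p (u * v)) (add : ∀ u v, p u → p v → p (u + v))
    (u : UniversalEnvelopingAlgebra k g) : p u := by
  let A : Subalgebra k (UniversalEnvelopingAlgebra k g) :=
    { carrier := {u | p u}
      mul_mem' := fun hu hv => mul _ _ hu hv
      add_mem' := fun hu hv => add _ _ hu hv
      algebraMap_mem' := algebraMap }
  let f : g →ₗ⁅k⁆ A :=
    { toFun := fun x => ⟨UniversalEnvelopingAlgebra.ι k x, ι x⟩
      map_add' := fun x y => Subtype.ext (map_add _ x y)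
      map_smul' := fun c x => Subtype.ext (map_smul _ c x)
      map_lie' := fun {x y} => Subtype.ext (LieHom.map_lie _ x y) }
  have h : A.val.comp (UniversalEnvelopingAlgebra.lift k f) = AlgHom.id k _ :=
    UniversalEnvelopingAlgebra.algHom_ext_ι k g fun x => by
      rw [AlgHom.comp_apply, UniversalEnvelopingAlgebra.lift_ι_apply]
      rfl
  have hu := (UniversalEnvelopingAlgebra.lift k f u).2
  have hu' := AlgHom.congr_fun h u
  rw [AlgHom.comp_apply, Subalgebra.coe_val, AlgHom.id_apply] at hu'
  rwa [hu'] at hu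

/-! ### The Poincaré–Birkhoff–Witt basis -/

section PBWBasis

variable {k g I : Type*} [Field k] [LieRing g] [LieAlgebra k g] [LinearOrder I]
variable (b : Module.Basis I k g)

/-- The PBW monomial `B ^ M` whose exponents are the multiplicities of the multiset `M`. -/
def envMonomial (M : Multiset I) : UniversalEnvelopingAlgebra k g :=
  pbwMonomial b (Multiset.toFinsupp M)

theorem envMonomial_zero : envMonomial b 0 = 1 := by
  simp [envMonomial, pbwMonomial, multiPow, orderedProd_empty]

theorem envMonomial_cons {i : I} {M : Multiset I} (h : ∀ j ∈ M, j ≤ i) :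
    envMonomial b (i ::ₘ M) = ι k (b i) * envMonomial b M := by
  rw [envMonomial, envMonomial, pbwMonomial, pbwMonomial, ← Multiset.singleton_add, map_add,
    Multiset.toFinsupp_singleton, multiPow_single_add]
  intro j hj
  exact h j (by simpa using hj)

/-- The action of the enveloping algebra on the symmetric algebra that extends `act`. -/
def envAct : UniversalEnvelopingAlgebra k g →ₐ[k] Module.End k (Multiset I →₀ k) :=
  UniversalEnvelopingAlgebra.lift k
    { act b with
      map_lie' := fun {x y} => LinearMap.ext fun s =>
        (sub_eq_zero.1 (lieDefect_eq_zero b x y s)).symm }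

theorem envAct_ι (x : g) : envAct b (ι k x) = act b x :=
  UniversalEnvelopingAlgebra.lift_ι_apply k _ x

theorem envAct_envMonomial (M : Multiset I) :
    envAct b (envMonomial b M) (symMonomial k 0) = symMonomial k M := by
  induction M using multiset_induction_max with
  | zero => rw [envMonomial_zero, map_one, Module.End.one_apply]
  | cons i M h ih =>
    rw [envMonomial_cons b h, map_mul, Module.End.mul_apply, ih, envAct_ι,
      act_symMonomial_of_le b h]

/-- The linear map from the symmetric to the enveloping algebra that takes `z_M` to `B ^ M`. -/
def toEnv : (Multiset I →₀ k) →ₗ[k] UniversalEnvelopingAlgebra k g :=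
  Finsupp.linearCombination k (envMonomial b)

theorem toEnv_symMonomial (M : Multiset I) : toEnv b (symMonomial k M) = envMonomial b M := by
  simp [toEnv]

/-- `toEnv` is `g`-linear: the recursion that defines the action mirrors the commutation relation
`b_i b_m = b_m b_i + ⁅b_i, b_m⁆` of the enveloping algebra. -/
theorem toEnv_act (x : g) (s : Multiset I →₀ k) : toEnv b (act b x s) = ι k x * toEnv b s := by
  have key : ∀ M : Multiset I, ∀ x : g,
      toEnv b (act b x (symMonomial k M)) = ι k x * toEnv b (symMonomial k M) := by
    intro M
    induction hn : M.card using Nat.strong_induction_on generalizing M with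
    | _ n ih =>
    subst hn
    intro x
    induction x using basis_induction b with
    | zero => simp
    | add x y hx hy => rw [map_add, LinearMap.add_apply, map_add, hx, hy, map_add, add_mul]
    | smul c x hx =>
      rw [map_smul, LinearMap.smul_apply, map_smul, hx, map_smul, smul_mul_assoc]
    | basis i =>
    by_cases hi : ∀ j ∈ M, j ≤ i
    · rw [act_symMonomial_of_le b hi, toEnv_symMonomial, toEnv_symMonomial, envMonomial_cons b hi]
    obtain ⟨m, L, hm, him, rfl⟩ := exists_eq_max_cons hi
    have hL : ∀ x : g, toEnv b (act b x (symMonomial k L)) = ι k x * toEnv b (symMonomial k L) :=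
      ih L.card (by simp) L rfl
    have hmi : ∀ l ∈ i ::ₘ L, l ≤ m := Multiset.forall_mem_cons.2 ⟨him.le, hm⟩
    -- The induction hypothesis applies to the remainder, whose degree is less than that
    -- of `z_{mL}`.
    have h1 : toEnv b (act b (b m) (act b (b i) (symMonomial k L) - symMonomial k (i ::ₘ L))) =
        ι k (b m) * toEnv b (act b (b i) (symMonomial k L) - symMonomial k (i ::ₘ L)) :=
      symFilt_induction
        (p := LinearMap.eqLocus (toEnv b ∘ₗ act b (b m))
          (LinearMap.mulLeft k (ι k (b m)) ∘ₗ toEnv b))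
        (fun P hP => ih P.card (by simpa using Nat.lt_succ_of_le hP) P rfl (b m))
        (act_symMonomial_sub_mem b i L)
    have h2 : toEnv b (act b (b m) (act b (b i) (symMonomial k L))) =
        ι k (b m) * (ι k (b i) * toEnv b (symMonomial k L)) := by
      rw [map_sub, map_sub, map_sub, mul_sub, act_symMonomial_of_le b hmi,
        toEnv_symMonomial b (m ::ₘ _), envMonomial_cons b hmi, toEnv_symMonomial b (i ::ₘ _),
        sub_left_inj] at h1
      rw [h1, hL]
    rw [act_symMonomial_cons b hm him, map_add, h2, hL, LieHom.map_lie,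
      LieRing.of_associative_ring_bracket, toEnv_symMonomial b (m ::ₘ _), envMonomial_cons b hm,
      toEnv_symMonomial]
    noncomm_ring
  have : toEnv b ∘ₗ act b x = LinearMap.mulLeft k (ι k x) ∘ₗ toEnv b := by
    ext1 M
    ext1
    simpa using key M x
  exact LinearMap.congr_fun this s

theorem toEnv_envAct (u : UniversalEnvelopingAlgebra k g) (s : Multiset I →₀ k) :
    toEnv b (envAct b u s) = u * toEnv b s := by
  induction u using envelopingAlgebra_induction generalizing s with
  | algebraMap c =>
    rw [AlgHom.commutes, Module.algebraMap_end_apply, map_smul, Algebra.smul_def]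
  | ι x => rw [envAct_ι, toEnv_act]
  | mul u v hu hv => rw [map_mul, Module.End.mul_apply, hu, hv, mul_assoc]
  | add u v hu hv => rw [map_add, LinearMap.add_apply, map_add, hu, hv, add_mul]

/-- The Poincaré–Birkhoff–Witt basis, indexed by multisets: `toEnv` is bijective, with inverse
`u ↦ u · z_0`. -/
def envBasis : Module.Basis (Multiset I) k (UniversalEnvelopingAlgebra k g) :=
  Module.Basis.ofRepr <| LinearEquiv.symm <| LinearEquiv.ofLinearMap (toEnv b)
    ((LinearMap.applyₗ (symMonomial k 0)) ∘ₗ (envAct b).toLinearMap)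
    (LinearMap.ext fun u => by
      simp [toEnv_envAct, toEnv_symMonomial, envMonomial_zero])
    (by
      ext1 M
      ext1
      simp [toEnv_symMonomial, envAct_envMonomial])

theorem envBasis_apply (M : Multiset I) : envBasis b M = envMonomial b M := toEnv_symMonomial b M

end PBWBasis

/-! ### Convolution of endomorphisms on monomials -/

section Convolution

variable {k g I : Type*} [Field k] [LieRing g] [LieAlgebra k g] [LinearOrder I]
variable (b : Module.Basis I k g)

theorem comul_ι (x : g) :
    Coalgebra.comul (R := k) (ι k x) = ι k x ⊗ₜ[k] 1 + 1 ⊗ₜ[k] ι k x :=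
  UniversalEnvelopingAlgebra.comulHom_ι k g x

theorem counit_ι (x : g) : Coalgebra.counit (R := k) (ι k x) = 0 :=
  UniversalEnvelopingAlgebra.counitHom_ι k g x

/-- The coproduct of `B ^ M` is the sum of `B ^ P ⊗ B ^ Q` over the splittings `M = P + Q`, counted
with multiplicity; this takes the place of binomial coefficients. -/
theorem comul_envMonomial (M : Multiset I) :
    Coalgebra.comul (R := k) (envMonomial b M) =
      (M.antidiagonal.map fun p => envMonomial b p.1 ⊗ₜ[k] envMonomial b p.2).sum := by
  induction M using multiset_induction_max with
  | zero => simp [envMonomial_zero, Bialgebra.comul_one, Algebra.TensorProduct.one_def]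
  | cons i M h ih =>
    have hp : ∀ p ∈ M.antidiagonal, (∀ j ∈ p.1, j ≤ i) ∧ ∀ j ∈ p.2, j ≤ i := by
      intro p hp
      rw [Multiset.mem_antidiagonal] at hp
      exact ⟨fun j hj => h j (hp ▸ Multiset.mem_add.2 (Or.inl hj)),
        fun j hj => h j (hp ▸ Multiset.mem_add.2 (Or.inr hj))⟩
    rw [envMonomial_cons b h, Bialgebra.comul_mul, ih, comul_ι, add_mul,
      Multiset.antidiagonal_cons, Multiset.map_add, Multiset.sum_add, Multiset.map_map,
      Multiset.map_map, add_comm, ← Multiset.sum_map_mul_left, ← Multiset.sum_map_mul_left]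
    congr 2 <;> refine Multiset.map_congr rfl fun p hpM => ?_
    · simp [envMonomial_cons b (hp p hpM).2]
    · simp [envMonomial_cons b (hp p hpM).1]

theorem convMul_envMonomial (φ ψ : ConvEnd k g) (M : Multiset I) :
    (φ * ψ) (envMonomial b M) =
      (M.antidiagonal.map fun p => φ (envMonomial b p.1) * ψ (envMonomial b p.2)).sum := by
  rw [LinearMap.convMul_apply, comul_envMonomial, map_multiset_sum, map_multiset_sum,
    Multiset.map_map, Multiset.map_map]
  rfl

theorem convOne_envMonomial (M : Multiset I) :
    (1 : ConvEnd k g) (envMonomial b M) = if M = 0 then 1 else 0 := by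
  rw [LinearMap.convOne_apply]
  induction M using multiset_induction_max with
  | zero => simp [envMonomial_zero]
  | cons i M h _ =>
    rw [envMonomial_cons b h, Bialgebra.counit_mul, counit_ι]
    simp

/-- If `T` takes `b_i` to itself and all other monomials to `0`, then its `n`-th convolution power
takes `b_i ^ n` to `n! b_i ^ n` and all other monomials to `0`. -/
theorem convPow_envMonomial {T : ConvEnd k g} {i : I}
    (hT : ∀ M, T (envMonomial b M) = if M = {i} then ι k (b i) else 0) (n : ℕ) (M : Multiset I) :
    (T ^ n) (envMonomial b M) =
      if M = Multiset.replicate n i then (n.factorial : k) • envMonomial b M else 0 := by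
  induction n generalizing M with
  | zero =>
    rw [pow_zero, convOne_envMonomial]
    by_cases hM : M = 0
    · simp [hM, envMonomial_zero]
    · simp [hM]
  | succ n ih =>
    have h1 := sum_antidiagonal_ite_singleton i
      (fun Q => ι k (b i) * (T ^ n) (envMonomial b Q)) M
    rw [pow_succ', convMul_envMonomial]
    simp only [hT, ite_mul, zero_mul]
    rw [h1, ih]
    by_cases hM : i ∈ M
    · obtain ⟨N, rfl⟩ := Multiset.exists_cons_of_mem hM
      rw [Multiset.erase_cons_head, Multiset.replicate_succ]
      simp only [Multiset.cons_inj_right]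
      by_cases hN : N = Multiset.replicate n i
      · have h2 : ∀ j ∈ N, j ≤ i := fun j hj => (Multiset.eq_of_mem_replicate (hN ▸ hj)).le
        rw [if_pos hN, if_pos hN, envMonomial_cons b h2, Multiset.count_cons_self, hN,
          Multiset.count_replicate_self, mul_smul_comm, ← Nat.cast_smul_eq_nsmul k, smul_smul,
          Nat.factorial_succ, Nat.cast_mul]
      · rw [if_neg hN, if_neg hN, mul_zero, smul_zero]
    · have h2 : M ≠ Multiset.replicate (n + 1) i := by
        rintro rfl
        exact hM (by simp)
      rw [Multiset.count_eq_zero.2 hM, zero_smul, if_neg h2]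

open Classical in
/-- The projection of the enveloping algebra onto the span of the monomials `B ^ M` in which only
indices from `T` occur, along the span of the other monomials. -/
def supportProj (T : Set I) : ConvEnd k g :=
  WithConv.toConv <|
    (envBasis b).constr (M' := UniversalEnvelopingAlgebra k g) k fun M =>
      if ∀ j ∈ M, j ∈ T then envMonomial b M else 0

open Classical in
theorem supportProj_envMonomial (T : Set I) (M : Multiset I) :
    supportProj b T (envMonomial b M) = if ∀ j ∈ M, j ∈ T then envMonomial b M else 0 := by
  have h : envBasis b M = envMonomial b M := envBasis_apply b M
  conv_lhs => rw [← h]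
  exact (envBasis b).constr_basis (M' := UniversalEnvelopingAlgebra k g) k _ M

theorem supportProj_empty : supportProj b ∅ = 1 := by
  refine WithConv.ext ((envBasis b).ext fun M => ?_)
  rw [envBasis_apply]
  refine (supportProj_envMonomial b _ M).trans
    (Eq.trans ?_ (convOne_envMonomial b M).symm)
  by_cases hM : M = 0
  · simp [hM, envMonomial_zero]
  · obtain ⟨j, hj⟩ := Multiset.exists_mem_of_ne_zero hM
    rw [if_neg hM, if_neg fun h => h j hj]

theorem envMonomial_mul_of_eq {i : I} {P Q : Multiset I} (hP : ∀ j ∈ P, j = i)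
    (hQ : ∀ j ∈ Q, j ≤ i) : envMonomial b P * envMonomial b Q = envMonomial b (P + Q) := by
  induction P using Multiset.induction_on with
  | empty => rw [envMonomial_zero, one_mul, zero_add]
  | cons j P ih =>
    obtain rfl : j = i := hP j (Multiset.mem_cons_self _ _)
    have hP' : ∀ l ∈ P, l = j := fun l hl => hP l (Multiset.mem_cons_of_mem hl)
    rw [envMonomial_cons b fun l hl => (hP' l hl).le, mul_assoc, ih hP', Multiset.cons_add,
      envMonomial_cons b]
    intro l hl
    rcases Multiset.mem_add.1 hl with hl | hl
    exacts [(hP' l hl).le, hQ l hl]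

/-- Convolution of projections: the terms that survive in the sum over the splittings
`M = P + Q` have product `B ^ P * B ^ Q = B ^ M`, so that only their number matters, and this is the
expansion of `∏ j ∈ M, (1_{i}(j) + 1_T(j)) = ∏ j ∈ M, 1_({i} ∪ T)(j)`. -/
theorem supportProj_singleton_mul {i : I} {T : Set I} (hT : ∀ j ∈ T, j < i) :
    supportProj b {i} * supportProj b T = supportProj b (insert i T) := by
  classical
  refine WithConv.ext ((envBasis b).ext fun M => ?_)
  rw [envBasis_apply]
  refine (convMul_envMonomial b _ _ M).trans
    (Eq.trans ?_ (supportProj_envMonomial b _ M).symm)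
  have hind : (fun j => ({i} : Set I).indicator (fun _ => (1 : k)) j
      + T.indicator (fun _ => (1 : k)) j) = (insert i T).indicator fun _ => 1 := by
    funext j
    by_cases hj : j = i
    · subst hj
      have hjT : j ∉ T := fun h => lt_irrefl j (hT j h)
      simp [hjT]
    · by_cases hjT : j ∈ T <;> simp [hj, hjT]
  have hprod := Multiset.prod_map_add (s := M) (f := ({i} : Set I).indicator fun _ => (1 : k))
    (g := T.indicator fun _ => (1 : k))
  rw [hind, prod_map_indicator] at hprod
  have hterm : ∀ p ∈ M.antidiagonal,
      supportProj b {i} (envMonomial b p.1) * supportProj b T (envMonomial b p.2) =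
        ((p.1.map (({i} : Set I).indicator fun _ => (1 : k))).prod
          * (p.2.map (T.indicator fun _ => (1 : k))).prod) • envMonomial b M := by
    intro p hp
    rw [Multiset.mem_antidiagonal] at hp
    rw [supportProj_envMonomial, supportProj_envMonomial, prod_map_indicator, prod_map_indicator]
    by_cases h1 : ∀ j ∈ p.1, j ∈ ({i} : Set I)
    · by_cases h2 : ∀ j ∈ p.2, j ∈ T
      · rw [if_pos h1, if_pos h2, if_pos h1, if_pos h2,
          envMonomial_mul_of_eq b h1 fun j hj => (hT j (h2 j hj)).le, hp, mul_one, one_smul]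
      · simp [h2]
    · rw [if_neg h1, if_neg h1, zero_mul, zero_mul, zero_smul]
  have hsum := congrArg (· • envMonomial b M) hprod
  rw [Multiset.sum_smul, Multiset.map_map] at hsum
  rw [Multiset.map_congr rfl hterm]
  exact hsum.symm.trans (by rw [ite_smul, one_smul, zero_smul])

/-- The finite partial products of the factorization. -/
theorem orderedProd_supportProj (F : Finset I) :
    orderedProd F (fun i => supportProj b {i}) = supportProj b (F : Set I) := by
  induction F using Finset.induction_on_max with
  | empty => rw [orderedProd_empty, Finset.coe_empty, supportProj_empty]
  | insert i F h ih =>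
    rw [orderedProd_insert h, ih, supportProj_singleton_mul b h, Finset.coe_insert]

end Convolution

/-! ### Pointwise convergence -/

section Convergence

variable {k g I : Type*} [Field k] [LieRing g] [LieAlgebra k g]

/-- As the maps are linear and the index set is directed, convergence can be tested on a basis. -/
theorem netConverges_of_basis {A J : Type*} [Preorder A] [IsDirectedOrder A] [Nonempty A]
    (B : Module.Basis J k (UniversalEnvelopingAlgebra k g)) {f : A → ConvEnd k g} {l : ConvEnd k g}
    (h : ∀ j, ∃ N, ∀ i ≥ N, f i (B j) = l (B j)) : NetConverges f l := by
  intro x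
  induction x using basis_induction B with
  | zero => exact ⟨Classical.arbitrary A, fun i _ => by rw [map_zero, map_zero]⟩
  | add x y hx hy =>
    obtain ⟨N, hN⟩ := hx
    obtain ⟨N', hN'⟩ := hy
    obtain ⟨N₀, h₁, h₂⟩ := exists_ge_ge N N'
    exact ⟨N₀, fun i hi => by rw [map_add, map_add, hN i (h₁.trans hi), hN' i (h₂.trans hi)]⟩
  | smul c x hx =>
    obtain ⟨N, hN⟩ := hx
    exact ⟨N, fun i hi => by rw [map_smul, map_smul, hN i hi]⟩
  | basis j => exact h j

/-- A family converges to the sum `l` if only one of its members, the one of index `e j`,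
contributes to the value at the basis vector `B j`. -/
theorem hasPointwiseSum_of_basis {J K : Type*}
    (B : Module.Basis J k (UniversalEnvelopingAlgebra k g)) {f : K → ConvEnd k g} {l : ConvEnd k g}
    (e : J → K) (h : ∀ j n, n ≠ e j → f n (B j) = 0) (h' : ∀ j, f (e j) (B j) = l (B j)) :
    HasPointwiseSum f l := by
  refine netConverges_of_basis B fun j => ⟨{e j}, fun F hF => ?_⟩
  rw [WithConv.ofConv_sum, LinearMap.sum_apply,
    Finset.sum_eq_single_of_mem (e j) (hF (Finset.mem_singleton_self _)) fun n _ hn => h j n hn]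
  exact h' j

variable [LinearOrder I] (b : Module.Basis I k g)

/-- The exponential of `S_{e_i} ⊗ b_i` is the projection onto the span of the powers of `b_i`: its
`n`-th term is the projection onto the line of `b_i ^ n`. -/
theorem isConvExp_supportProj [CharZero k] {T : ConvEnd k g} {i : I}
    (hT : ∀ M, T (envMonomial b M) = if M = {i} then ι k (b i) else 0) :
    IsConvExp T (supportProj b {i}) := by
  have hterm : ∀ (M : Multiset I) (n : ℕ),
      (((n.factorial : k)⁻¹) • T ^ n) (envMonomial b M) =
        if M = Multiset.replicate n i then envMonomial b M else 0 := by
    intro M n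
    have hn : (n.factorial : k) ≠ 0 := Nat.cast_ne_zero.2 n.factorial_ne_zero
    rw [WithConv.ofConv_smul, LinearMap.smul_apply, convPow_envMonomial b hT, smul_ite, smul_smul,
      inv_mul_cancel₀ hn, one_smul, smul_zero]
  refine hasPointwiseSum_of_basis (envBasis b) Multiset.card (fun M n hn => ?_) fun M => ?_
  · rw [envBasis_apply, hterm, if_neg]
    rintro rfl
    simp at hn
  · rw [envBasis_apply, hterm, supportProj_envMonomial]
    simp only [Multiset.eq_replicate_card, Set.mem_singleton_iff]

theorem hasOrderedProd_supportProj :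
    HasOrderedProd (fun i => supportProj b {i}) (WithConv.toConv LinearMap.id) := by
  refine netConverges_of_basis (envBasis b) fun M => ⟨M.toFinset, fun F hF => ?_⟩
  rw [orderedProd_supportProj, envBasis_apply, supportProj_envMonomial, if_pos]
  · rfl
  · exact fun j hj => hF (Multiset.mem_toFinset.2 hj)

theorem tensorEnd_apply (f : Module.Dual k (UniversalEnvelopingAlgebra k g))
    (v x : UniversalEnvelopingAlgebra k g) : tensorEnd f v x = f x • v :=
  rfl

end Convergence

end PBWFactorization

end

theorem theorem1 {k g I : Type*} [Field k] [CharZero k] [LieRing g] [LieAlgebra k g]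
    [LinearOrder I] (b : Module.Basis I k g) :
    -- the monomials `B ^ α` form a basis of `U(g)`, so that their dual family exists
    (∃ B : Module.Basis (I →₀ ℕ) k (UniversalEnvelopingAlgebra k g),
      ∀ α, B α = PBWFactorization.pbwMonomial b α) ∧
    -- the factorization, for the dual family `S`
    ∀ S : (I →₀ ℕ) → Module.Dual k (UniversalEnvelopingAlgebra k g),
      (∀ α β, S α (PBWFactorization.pbwMonomial b β) = Finsupp.single α (1 : k) β) →
      -- the sum over all `α` converges, to the identity
      PBWFactorization.HasPointwiseSum
        (fun α : I →₀ ℕ =>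
          PBWFactorization.tensorEnd (S α) (PBWFactorization.pbwMonomial b α))
        (WithConv.toConv LinearMap.id) ∧
      -- all the exponentials exist, and their ordered product converges, to the identity
      ∃ E : I → PBWFactorization.ConvEnd k g,
        (∀ i, PBWFactorization.IsConvExp
          (PBWFactorization.tensorEnd (S (Finsupp.single i 1))
            (PBWFactorization.pbwMonomial b (Finsupp.single i 1))) (E i)) ∧
        PBWFactorization.HasOrderedProd E (WithConv.toConv LinearMap.id) := by
  open PBWFactorization in
  refine ⟨⟨(envBasis b).reindex Multiset.toFinsupp.toEquiv, fun α => ?_⟩, fun S hS => ⟨?_,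
    fun i => supportProj b {i}, fun i => ?_, hasOrderedProd_supportProj b⟩⟩
  · rw [Module.Basis.reindex_apply, envBasis_apply, envMonomial]
    exact congrArg _ (Multiset.toFinsupp.apply_symm_apply α)
  · refine hasPointwiseSum_of_basis (envBasis b) Multiset.toFinsupp (fun M α hα => ?_) fun M => ?_
    · rw [tensorEnd_apply, envBasis_apply, envMonomial, hS, Finsupp.single_eq_of_ne hα.symm,
        zero_smul]
    · rw [tensorEnd_apply, envBasis_apply, envMonomial, hS, Finsupp.single_eq_same, one_smul]
      rfl
  · refine isConvExp_supportProj b fun M => ?_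
    have hi : pbwMonomial b (Finsupp.single i 1) =
        UniversalEnvelopingAlgebra.ι k (b i) := by
      have h := envMonomial_cons b (i := i) (M := 0) (by simp)
      rwa [envMonomial_zero, mul_one, Multiset.cons_zero, envMonomial,
        Multiset.toFinsupp_singleton] at h
    rw [tensorEnd_apply, hi, envMonomial, hS, Finsupp.single_apply, ite_smul, one_smul, zero_smul]
    simp only [← Multiset.toFinsupp_singleton, EmbeddingLike.apply_eq_iff_eq, eq_comm]
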